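/- A (two-variable Boolean) predicate is a function $P:\{0,1\}^2\to\{0,1\}$. A VCSP instance $\mathcal I=(V,\Pi,w)$ using only $P$ consists of a finite set $V$ of variables, a set $\Pi$ of constraints of the form $\langle (v,u),P\rangle$ with $(v,u)\in V\times V$, and a weight function $w:\Pi\to[0,\infty)$. The value of an assignment $A:V\to\{0,1\}$ is $$\mathrm{Val}_{\mathcal I}(A)=\sum_{\langle (v,u),P\rangle\in\Pi} w(\langle (v,u),P\rangle)\cdot P(A(v),A(u)).$$ For $\epsilon\in(0,1)$, an $\epsilon$-sparsifier of $\mathcal I$ is an instance $\mathcal I_\epsilon=(V,\Pi_\epsilon,w_\epsilon)$ with $\Pi_\epsilon\subseteq\Pi$ and $w_\epsilon:\Pi_\epsilon\to[0,\infty)$ such that $(1-\epsilon)\,\mathrm{Val}_{\mathcal I}(A)\le \mathrm{Val}_{\mathcal I_\epsilon}(A)\le(1+\epsilon)\,\mathrm{Val}_{\mathcal I}(A)$ for every $A:V\to\{0,1\}$. Theorem. There are absolute constants $c,C>0$ such that the following holds for every predicate $P$ and every $\epsilon\in(0,1)$. 1. If $|P^{-1}(1)|=1$, then on every finite set $V$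 of variables with $|V|\ge 2$ there is a VCSP instance $\mathcal I=(V,\Pi,w)$ using only $P$ such that every $\epsilon$-sparsifier of $\mathcal I$ has at least $c\,|V|^2$ constraints. 2. If $|P^{-1}(1)|\ne 1$, then every VCSP instance $\mathcal I=(V,\Pi,w)$ using only $P$ has an $\epsilon$-sparsifier with at most $C\,|V|/\epsilon^2$ constraints. -/

import Mathlib

open scoped NNReal

universe u

/-- A two-variable Boolean predicate `P : {0,1}² → {0,1}`. -/
abbrev BinaryPredicate : Type := Bool × Bool → Bool

/-- The number `|P⁻¹(1)|` of ones in the truth table of `P`. -/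
def BinaryPredicate.numSatisfying (P : BinaryPredicate) : ℕ :=
  (Finset.univ.filter fun x : Bool × Bool => P x = true).card

/-- A constraint `⟨(v, u), P⟩` over the variables `V`: an ordered pair of variables together with
a predicate. The two variables are not required to be distinct. -/
structure VCSPConstraint (V : Type u) where
  scope : V × V
  pred : BinaryPredicate

/-- The assignment `A` satisfies `⟨(v, u), P⟩` if `P (A v, A u) = 1`. -/
def VCSPConstraint.IsSatisfiedBy {V : Type u} (c : VCSPConstraint V) (A : V → Bool) : Prop :=
  c.pred (A c.scope.1, A c.scope.2) = true

instance {V : Type u} (c : VCSPConstraint V) (A : V → Bool) : Decidable (c.IsSatisfiedBy A) :=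
  inferInstanceAs (Decidable (_ = true))

/-- A VCSP instance `(V, Π, w)`: a finite set of constraints over `V` with nonnegative weights.
The weight function is extended to all constraints over `V` for convenience; only its values on
`constraints` are ever used. -/
structure VCSP (V : Type u) where
  constraints : Finset (VCSPConstraint V)
  weight : VCSPConstraint V → ℝ≥0

namespace VCSP

variable {V : Type u}

/-- The value of an assignment: the total weight of the constraints that it satisfies. -/
noncomputable def value (I : VCSP V) (A : V → Bool) : ℝ :=
  ∑ c ∈ I.constraints, (I.weight c : ℝ) * (if c.IsSatisfiedBy A then 1 else 0)

/-- Every constraint of the instance uses the predicate `P`. -/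
def UsesOnly (I : VCSP V) (P : BinaryPredicate) : Prop :=
  ∀ c ∈ I.constraints, c.pred = P

/-- `J` is an `ε`-sparsifier of `I`: a re-weighted sub-instance whose value agrees with that of `I`
up to a factor `1 ± ε` under every assignment. -/
def IsSparsifier (ε : ℝ) (J I : VCSP V) : Prop :=
  J.constraints ⊆ I.constraints ∧
    ∀ A : V → Bool, (1 - ε) * I.value A ≤ J.value A ∧ J.value A ≤ (1 + ε) * I.value A

end VCSP

/-! The dividing line is whether `P x y = |f x + g y|²` for complex functions `f`, `g`. If so, the
value of an assignment is a positive semidefinite Hermitian form, a sum of one rank-one form per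
constraint, evaluated at the 0/1 indicator of the pairs `(v, A v)` in dimension `2|V|`. The
Batson–Spielman–Srivastava theorem then keeps `O(|V|/ε²)` of the rank-one terms. Every predicate
with a number of ones other than one has such a representation
(`BinaryPredicate.exists_normSq_add_eq`). With exactly one 1 there is none, since three zeros of `f
x + g y` force the fourth.

For those remaining predicates, on a complete bipartite instance each constraint is the only one
satisfied by some assignment, so none can be dropped.

The sparsification theorem is proved by barriers: a weighted sum `A` of rank-one matrices is kept
strictly between `l • 1` and `u • 1`, with the traces of `(u • 1 - A)⁻¹` and `(A - l • 1)⁻¹` at most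
`η`. Each step moves both barriers and adds one term (`exists_barrier_step`); after many steps `u /
l` is close to 1. -/

open Matrix ComplexConjugate
open scoped ComplexOrder

/-! ### Rank-one updates of positive definite matrices -/

namespace Matrix

variable {n : Type*}

theorem PosDef.re_dotProduct_mulVec_pos [Fintype n] {X : Matrix n n ℂ} (hX : X.PosDef) {x : n → ℂ}
    (hx : x ≠ 0) : 0 < (star x ⬝ᵥ X *ᵥ x).re :=
  (Complex.pos_iff.1 (hX.dotProduct_mulVec_pos hx)).1

theorem IsHermitian.star_mulVec_dotProduct [Fintype n] {X : Matrix n n ℂ} (hX : X.IsHermitian) (x y : n → ℂ) :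
    star (X *ᵥ x) ⬝ᵥ y = star x ⬝ᵥ X *ᵥ y := by
  rw [star_mulVec, hX.eq, dotProduct_mulVec]

theorem IsHermitian.ofReal_re_dotProduct_mulVec [Fintype n] {X : Matrix n n ℂ} (hX : X.IsHermitian)
    (x : n → ℂ) : (((star x ⬝ᵥ X *ᵥ x).re : ℝ) : ℂ) = star x ⬝ᵥ X *ᵥ x := by
  have h : conj (star x ⬝ᵥ X *ᵥ x) = star x ⬝ᵥ X *ᵥ x := by
    rw [starRingEnd_apply, ← star_dotProduct, hX.star_mulVec_dotProduct]
  exact Complex.conj_eq_iff_re.1 h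

theorem star_dotProduct_vecMulVec_mulVec [Fintype n] (v x : n → ℂ) :
    star x ⬝ᵥ vecMulVec v (star v) *ᵥ x = (Complex.normSq (star v ⬝ᵥ x) : ℂ) := by
  rw [vecMulVec_mulVec, Complex.normSq_eq_conj_mul_self, starRingEnd_apply, ← star_dotProduct,
    dotProduct_smul, MulOpposite.smul_eq_mul_unop, MulOpposite.unop_op]

theorem sum_star_dotProduct_mulVec [Fintype n] [DecidableEq n] {ι : Type*} [Fintype ι] (v : ι → n → ℂ)
    (hv : ∑ i, vecMulVec (v i) (star (v i)) = 1) (M : Matrix n n ℂ) :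
    ∑ i, star (v i) ⬝ᵥ M *ᵥ v i = M.trace := by
  have h (i : ι) : star (v i) ⬝ᵥ M *ᵥ v i = (M * vecMulVec (v i) (star (v i))).trace := by
    rw [mul_vecMulVec, trace_vecMulVec, dotProduct_comm]
  rw [Finset.sum_congr rfl fun i _ => h i, ← trace_sum, ← Finset.mul_sum, hv, mul_one]

/-- Cauchy–Schwarz for the inner product given by a positive definite matrix. -/
theorem PosDef.normSq_dotProduct_le [Fintype n] [DecidableEq n] {X : Matrix n n ℂ} (hX : X.PosDef) (v x : n → ℂ) :
    Complex.normSq (star v ⬝ᵥ x) ≤ (star v ⬝ᵥ X⁻¹ *ᵥ v).re * (star x ⬝ᵥ X *ᵥ x).re := by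
  rcases eq_or_ne v 0 with rfl | hv
  · simp
  have hr := hX.inv.re_dotProduct_mulVec_pos hv
  have hrc := hX.inv.isHermitian.ofReal_re_dotProduct_mulVec v
  have hqc := hX.isHermitian.ofReal_re_dotProduct_mulVec x
  set r := (star v ⬝ᵥ X⁻¹ *ᵥ v).re
  set q := (star x ⬝ᵥ X *ᵥ x).re
  have hdet : IsUnit X.det := (isUnit_iff_isUnit_det _).1 hX.isUnit
  have hXy : X *ᵥ (X⁻¹ *ᵥ v) = v := by rw [mulVec_mulVec, mul_nonsing_inv _ hdet, one_mulVec]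
  set a := star v ⬝ᵥ x with ha
  have hxa : star x ⬝ᵥ v = conj a := by
    rw [ha, starRingEnd_apply, ← star_dotProduct]
  have hyx : star (X⁻¹ *ᵥ v) ⬝ᵥ X *ᵥ x = a := by
    rw [← hX.isHermitian.star_mulVec_dotProduct, hXy]
  have hyv : star (X⁻¹ *ᵥ v) ⬝ᵥ v = r := by
    rw [hX.inv.isHermitian.star_mulVec_dotProduct, hrc]
  have key : star ((r : ℂ) • x - a • (X⁻¹ *ᵥ v)) ⬝ᵥ X *ᵥ ((r : ℂ) • x - a • (X⁻¹ *ᵥ v))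
      = ((r * (r * q - Complex.normSq a) : ℝ) : ℂ) := by
    simp only [mulVec_sub, mulVec_smul, hXy, star_sub, star_smul, sub_dotProduct, dotProduct_sub,
      smul_dotProduct, dotProduct_smul, hxa, hyx, hyv, ← hqc, smul_eq_mul]
    push_cast
    rw [Complex.normSq_eq_conj_mul_self]
    simp only [RCLike.star_def, Complex.conj_ofReal]
    ring
  have h0 := hX.posSemidef.dotProduct_mulVec_nonneg ((r : ℂ) • x - a • (X⁻¹ *ᵥ v))
  rw [key, Complex.zero_le_real] at h0
  have := nonneg_of_mul_nonneg_right h0 hr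
  linarith

theorem isHermitian_vecMulVec_star [Fintype n] (v : n → ℂ) : (vecMulVec v (star v)).IsHermitian :=
  (posSemidef_vecMulVec_self_star v).isHermitian

theorem isHermitian_ofReal_smul {A : Matrix n n ℂ} (hA : A.IsHermitian) (s : ℝ) :
    ((s : ℂ) • A).IsHermitian := by
  rw [IsHermitian, conjTranspose_smul, hA.eq]; simp

/-- Only negative `s` needs care: by Cauchy–Schwarz the update then lowers the form of `X` by at
most the factor `1 + s * r`, with `r` the form of `X⁻¹` at `v`. -/
theorem PosDef.add_smul_vecMulVec [Fintype n] [DecidableEq n] {X : Matrix n n ℂ} (hX : X.PosDef) (v : n → ℂ) {s : ℝ}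
    (hs : 0 < 1 + s * (star v ⬝ᵥ X⁻¹ *ᵥ v).re) :
    (X + (s : ℂ) • vecMulVec v (star v)).PosDef := by
  refine PosDef.of_dotProduct_mulVec_pos
    (hX.isHermitian.add (isHermitian_ofReal_smul (isHermitian_vecMulVec_star v) s)) fun x hx => ?_
  have hq := hX.re_dotProduct_mulVec_pos hx
  have hcs := hX.normSq_dotProduct_le v x
  rw [add_mulVec, dotProduct_add, smul_mulVec, dotProduct_smul, star_dotProduct_vecMulVec_mulVec,
    ← hX.isHermitian.ofReal_re_dotProduct_mulVec x, smul_eq_mul, ← Complex.ofReal_mul,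
    ← Complex.ofReal_add, Complex.zero_lt_real]
  rcases le_or_gt 0 s with h | h
  · have := mul_nonneg h (Complex.normSq_nonneg (star v ⬝ᵥ x))
    linarith
  · have h1 := mul_le_mul_of_nonpos_left hcs h.le
    have h2 := mul_pos hs hq
    linarith

/-- The Sherman–Morrison formula, after taking traces. -/
theorem PosDef.trace_inv_add_smul_vecMulVec [Fintype n] [DecidableEq n] {X : Matrix n n ℂ} (hX : X.PosDef) (v : n → ℂ) {s : ℝ}
    (hs : 0 < 1 + s * (star v ⬝ᵥ X⁻¹ *ᵥ v).re) :
    (X + (s : ℂ) • vecMulVec v (star v))⁻¹.trace.re = X⁻¹.trace.re -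
      s * (star v ⬝ᵥ (X⁻¹ * X⁻¹) *ᵥ v).re / (1 + s * (star v ⬝ᵥ X⁻¹ *ᵥ v).re) := by
  have hrc := hX.inv.isHermitian.ofReal_re_dotProduct_mulVec v
  set r := (star v ⬝ᵥ X⁻¹ *ᵥ v).re
  have hdet : IsUnit X.det := (isUnit_iff_isUnit_det _).1 hX.isUnit
  have hXy : X *ᵥ (X⁻¹ *ᵥ v) = v := by rw [mulVec_mulVec, mul_nonsing_inv _ hdet, one_mulVec]
  have hys : star v ᵥ* X⁻¹ = star (X⁻¹ *ᵥ v) := by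
    rw [star_mulVec, hX.inv.isHermitian.eq]
  set y := X⁻¹ *ᵥ v with hy
  set k : ℝ := s / (1 + s * r)
  have hk : s - k - k * s * r = 0 := by simp only [k]; field_simp; ring
  have hinv : (X + (s : ℂ) • vecMulVec v (star v))⁻¹ =
      X⁻¹ - (k : ℂ) • vecMulVec y (star y) := by
    refine inv_eq_right_inv ?_
    have : (X + (s : ℂ) • vecMulVec v (star v)) * (X⁻¹ - (k : ℂ) • vecMulVec y (star y))
        = 1 + ((s - k - k * s * r : ℝ) : ℂ) • vecMulVec v (star y) := by
      rw [add_mul, mul_sub, mul_sub, mul_nonsing_inv _ hdet, smul_mul_assoc, smul_mul_assoc,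
        mul_smul_comm, mul_smul_comm, mul_vecMulVec, hXy, vecMulVec_mul, hys,
        vecMulVec_mul_vecMulVec, ← hrc, vecMulVec_smul]
      push_cast
      module
    rw [this, hk]; simp
  rw [hinv, trace_sub, trace_smul, trace_vecMulVec, ← mulVec_mulVec, ← hy,
    ← hX.inv.isHermitian.star_mulVec_dotProduct, ← hy, dotProduct_comm y, Complex.sub_re,
    smul_eq_mul, Complex.re_ofReal_mul]
  simp only [k]; ring

end Matrix

/-! ### Barrier shifts and the barrier step -/

namespace Matrix

variable {n : Type*} [Fintype n] [DecidableEq n]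

/-- The Hermitian matrix with eigenvalues `f` in the orthonormal basis given by the columns
of `U`. -/
noncomputable def unitaryDiag (U : unitaryGroup n ℂ) (f : n → ℝ) : Matrix n n ℂ :=
  (U : Matrix n n ℂ) * diagonal (fun i => (f i : ℂ)) * star (U : Matrix n n ℂ)

theorem IsHermitian.eq_unitaryDiag {A : Matrix n n ℂ} (hA : A.IsHermitian) :
    A = unitaryDiag hA.eigenvectorUnitary hA.eigenvalues := by
  conv_lhs => rw [hA.spectral_theorem, Unitary.conjStarAlgAut_apply]
  rfl

section unitaryDiag

variable (U : unitaryGroup n ℂ)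

theorem unitaryDiag_mul (f g : n → ℝ) :
    unitaryDiag U f * unitaryDiag U g = unitaryDiag U (f * g) := by
  have h : star (U : Matrix n n ℂ) * (U : Matrix n n ℂ) = 1 := Unitary.coe_star_mul_self U
  calc _ = (U : Matrix n n ℂ) * diagonal (fun i => (f i : ℂ)) *
        (star (U : Matrix n n ℂ) * (U : Matrix n n ℂ)) * diagonal (fun i => (g i : ℂ)) *
        star (U : Matrix n n ℂ) := by simp only [unitaryDiag, mul_assoc]
    _ = _ := by
      rw [h, mul_one, mul_assoc (U : Matrix n n ℂ), diagonal_mul_diagonal]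
      simp [unitaryDiag]

theorem unitaryDiag_one : unitaryDiag U 1 = 1 := by
  simp [unitaryDiag]

theorem unitaryDiag_add_smul_one (f : n → ℝ) (c : ℝ) :
    unitaryDiag U f + (c : ℂ) • 1 = unitaryDiag U (fun i => f i + c) := by
  have h : (c : ℂ) • (1 : Matrix n n ℂ) =
      (U : Matrix n n ℂ) * diagonal (fun _ => (c : ℂ)) * star (U : Matrix n n ℂ) := by
    rw [← smul_one_eq_diagonal, mul_smul_comm, mul_one, smul_mul_assoc]
    simp
  rw [h, unitaryDiag, unitaryDiag, ← add_mul, ← mul_add, diagonal_add]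
  simp

theorem unitaryDiag_inv {f : n → ℝ} (hf : ∀ i, f i ≠ 0) :
    (unitaryDiag U f)⁻¹ = unitaryDiag U (fun i => (f i)⁻¹) := by
  refine inv_eq_right_inv ?_
  rw [unitaryDiag_mul, ← unitaryDiag_one U]
  congr 1
  ext i
  simp [hf i]

theorem trace_unitaryDiag (f : n → ℝ) : (unitaryDiag U f).trace.re = ∑ i, f i := by
  rw [unitaryDiag, trace_mul_comm, ← mul_assoc, Unitary.coe_star_mul_self, one_mul,
    trace_diagonal]
  simp

theorem posDef_unitaryDiag_iff (f : n → ℝ) : (unitaryDiag U f).PosDef ↔ ∀ i, 0 < f i := by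
  rw [unitaryDiag, IsUnit.posDef_star_right_conjugate_iff (U := (U : Matrix n n ℂ)) (Unitary.toUnits U).isUnit,
    posDef_diagonal_iff]
  simp

end unitaryDiag

/-- Shifting the lower barrier by one. -/
theorem PosDef.sub_one_of_trace_inv_le [Nonempty n] {X : Matrix n n ℂ} (hX : X.PosDef) {η : ℝ}
    (hη : η < 1) (hX' : X⁻¹.trace.re ≤ η) :
    (X - 1).PosDef ∧ X⁻¹.trace.re < (X - 1)⁻¹.trace.re ∧
      ((X - 1)⁻¹.trace.re - X⁻¹.trace.re) * (1 - η + (X - 1)⁻¹.trace.re) ≤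
        ((X - 1)⁻¹ * (X - 1)⁻¹).trace.re := by
  obtain ⟨U, f, rfl⟩ : ∃ U f, X = unitaryDiag U f := ⟨_, _, hX.isHermitian.eq_unitaryDiag⟩
  have hf := (posDef_unitaryDiag_iff U f).1 hX
  have hsub : unitaryDiag U f - 1 = unitaryDiag U (fun i => f i - 1) := by
    have := unitaryDiag_add_smul_one U f (-1)
    simpa [sub_eq_add_neg] using this
  rw [unitaryDiag_inv U fun i => (hf i).ne', trace_unitaryDiag] at hX'
  -- The trace of the inverse is below 1, so every eigenvalue exceeds 1 and the barrier can move by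
  -- 1.
  have hf1 (i : n) : 0 < f i - 1 := by
    have h1 : (f i)⁻¹ ≤ ∑ i, (f i)⁻¹ :=
      Finset.single_le_sum (f := fun i => (f i)⁻¹) (fun j _ => (inv_pos.2 (hf j)).le)
        (Finset.mem_univ i)
    have h2 : (f i)⁻¹ < 1 := by linarith
    have := (inv_lt_one₀ (hf i)).1 h2
    linarith
  rw [hsub, unitaryDiag_inv U fun i => (hf i).ne', unitaryDiag_inv U fun i => (hf1 i).ne',
    unitaryDiag_mul, trace_unitaryDiag, trace_unitaryDiag, trace_unitaryDiag]
  have hab (i : n) : (f i - 1)⁻¹ - (f i)⁻¹ = (f i)⁻¹ * (f i - 1)⁻¹ := by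
    have := (hf i).ne'; have := (hf1 i).ne'
    field_simp; ring
  have ha (i : n) : 0 < (f i)⁻¹ := inv_pos.2 (hf i)
  have hb (i : n) : 0 < (f i - 1)⁻¹ := inv_pos.2 (hf1 i)
  refine ⟨(posDef_unitaryDiag_iff U _).2 hf1, ?_, ?_⟩
  · refine Finset.sum_lt_sum_of_nonempty Finset.univ_nonempty fun i _ => ?_
    have := mul_pos (ha i) (hb i)
    linarith [hab i]
  · set a := fun i => (f i)⁻¹
    set b := fun i => (f i - 1)⁻¹
    have hD : ∑ i, b i - ∑ i, a i = ∑ i, a i * b i := by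
      rw [← Finset.sum_sub_distrib]; exact Finset.sum_congr rfl fun i _ => hab i
    have hcs : (∑ i, a i * b i) ^ 2 ≤ (∑ i, a i) * ∑ i, a i * b i ^ 2 :=
      Finset.sum_sq_le_sum_mul_sum_of_sq_le_mul _ (fun i _ => (ha i).le)
        (fun i _ => mul_nonneg (ha i).le (sq_nonneg _)) (fun i _ => le_of_eq (by ring))
    have hbb : ∑ i, b i * b i = ∑ i, a i * b i + ∑ i, a i * b i ^ 2 := by
      rw [← Finset.sum_add_distrib]
      refine Finset.sum_congr rfl fun i _ => ?_
      have : b i - a i = a i * b i := hab i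
      linear_combination b i * this
    have hS : 0 ≤ ∑ i, a i * b i := Finset.sum_nonneg fun i _ => mul_nonneg (ha i).le (hb i).le
    have hT : 0 ≤ ∑ i, a i * b i ^ 2 :=
      Finset.sum_nonneg fun i _ => mul_nonneg (ha i).le (sq_nonneg _)
    change (∑ i, b i - ∑ i, a i) * (1 - η + ∑ i, b i) ≤ ∑ i, b i * b i
    rw [hbb, show ∑ i, b i = ∑ i, a i * b i + ∑ i, a i by linarith]
    have h1 : ∑ i, a i ≤ η := hX'
    -- With `S = ∑ a b` and `T = ∑ a b²` the claim is `S (∑ a - η) + S² ≤ T`, and `S² ≤ (∑ a) T ≤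
    -- T`.
    nlinarith [mul_nonneg hS (sub_nonneg.2 h1), mul_nonneg hT (sub_nonneg.2 (h1.trans hη.le))]

/-- Shifting the upper barrier by `δ`. -/
theorem PosDef.add_smul_one_trace_inv [Nonempty n] {X : Matrix n n ℂ} (hX : X.PosDef) {δ : ℝ}
    (hδ : 0 < δ) :
    (X + (δ : ℂ) • 1).PosDef ∧ (X + (δ : ℂ) • 1)⁻¹.trace.re < X⁻¹.trace.re ∧
      ((X + (δ : ℂ) • 1)⁻¹ * (X + (δ : ℂ) • 1)⁻¹).trace.re ≤
        (X⁻¹.trace.re - (X + (δ : ℂ) • 1)⁻¹.trace.re) * δ⁻¹ := by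
  obtain ⟨U, f, rfl⟩ : ∃ U f, X = unitaryDiag U f := ⟨_, _, hX.isHermitian.eq_unitaryDiag⟩
  have hf := (posDef_unitaryDiag_iff U f).1 hX
  have hf1 (i : n) : 0 < f i + δ := add_pos (hf i) hδ
  rw [unitaryDiag_add_smul_one, unitaryDiag_inv U fun i => (hf i).ne',
    unitaryDiag_inv U fun i => (hf1 i).ne',
    unitaryDiag_mul, trace_unitaryDiag, trace_unitaryDiag, trace_unitaryDiag]
  have hlt (i : n) : (f i + δ)⁻¹ < (f i)⁻¹ := inv_strictAnti₀ (hf i) (by linarith)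
  refine ⟨(posDef_unitaryDiag_iff U _).2 hf1, ?_, ?_⟩
  · exact Finset.sum_lt_sum_of_nonempty Finset.univ_nonempty fun i _ => hlt i
  · rw [← Finset.sum_sub_distrib, Finset.sum_mul]
    refine Finset.sum_le_sum fun i _ => ?_
    have h : ((f i)⁻¹ - (f i + δ)⁻¹) * δ⁻¹ = (f i)⁻¹ * (f i + δ)⁻¹ := by
      have := (hf i).ne'; have := (hf1 i).ne'
      field_simp; ring
    rw [h]
    exact mul_le_mul_of_nonneg_right (hlt i).le (inv_pos.2 (hf1 i)).le

/-- One step of the barrier argument of Batson, Spielman and Srivastava. -/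
theorem exists_barrier_step [Nonempty n] {ι : Type*} [Fintype ι] {v : ι → n → ℂ}
    (hv : ∑ i, vecMulVec (v i) (star (v i)) = 1) {X Z : Matrix n n ℂ} (hX : X.PosDef)
    (hZ : Z.PosDef) {η δ : ℝ} (hδ : 0 < δ) (hηδ : δ⁻¹ + η < 1 - η) (hXη : X⁻¹.trace.re ≤ η)
    (hZη : Z⁻¹.trace.re ≤ η) :
    ∃ (i : ι) (t : ℝ), 0 < t ∧
      (X + (δ : ℂ) • 1 - (t : ℂ) • vecMulVec (v i) (star (v i))).PosDef ∧
      (Z - 1 + (t : ℂ) • vecMulVec (v i) (star (v i))).PosDef ∧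
      (X + (δ : ℂ) • 1 - (t : ℂ) • vecMulVec (v i) (star (v i)))⁻¹.trace.re ≤ η ∧
      (Z - 1 + (t : ℂ) • vecMulVec (v i) (star (v i)))⁻¹.trace.re ≤ η := by
  have hη0 : 0 ≤ η := (Complex.nonneg_iff.1 hX.inv.posSemidef.trace_nonneg).1.trans hXη
  have hδ' := inv_pos.2 hδ
  obtain ⟨hX', hXlt, hXsq⟩ := hX.add_smul_one_trace_inv hδ
  obtain ⟨hZ', hZlt, hZsq⟩ := hZ.sub_one_of_trace_inv_le (by linarith) hZη
  set X' := X + (δ : ℂ) • 1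
  set Z' := Z - 1
  set D := X⁻¹.trace.re - X'⁻¹.trace.re with hD
  set E := Z'⁻¹.trace.re - Z⁻¹.trace.re with hE
  have hD0 : 0 < D := sub_pos.2 hXlt
  have hE0 : 0 < E := sub_pos.2 hZlt
  let q (M : Matrix n n ℂ) (i : ι) : ℝ := (star (v i) ⬝ᵥ M *ᵥ v i).re
  have hq (M : Matrix n n ℂ) : ∑ i, q M i = M.trace.re := by
    simp only [q]
    rw [← Complex.re_sum, sum_star_dotProduct_mulVec v hv]
  have hq0 {M : Matrix n n ℂ} (hM : M.PosSemidef) (i : ι) : 0 ≤ q M i :=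
    (Complex.nonneg_iff.1 (hM.dotProduct_mulVec_nonneg (v i))).1
  have hsq {M : Matrix n n ℂ} (hM : M.PosDef) : (M⁻¹ * M⁻¹).PosSemidef := by
    have := posSemidef_conjTranspose_mul_self M⁻¹
    rwa [hM.inv.isHermitian.eq] at this
  -- Averaging over `i`: the left side sums to at most `δ⁻¹ + η`, the right side to at least `1 -
  -- η`.
  obtain ⟨i, -, hi⟩ : ∃ i ∈ Finset.univ, q (X'⁻¹ * X'⁻¹) i / D + q X'⁻¹ i <
      q (Z'⁻¹ * Z'⁻¹) i / E - q Z'⁻¹ i := by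
    refine Finset.exists_lt_of_sum_lt ?_
    rw [Finset.sum_add_distrib, Finset.sum_sub_distrib, ← Finset.sum_div, ← Finset.sum_div,
      hq, hq, hq, hq]
    have h1 : (X'⁻¹ * X'⁻¹).trace.re / D ≤ δ⁻¹ := (div_le_iff₀ hD0).2 (by linarith)
    have h2 : 1 - η + Z'⁻¹.trace.re ≤ (Z'⁻¹ * Z'⁻¹).trace.re / E :=
      (le_div_iff₀ hE0).2 (by linarith)
    linarith
  have hp := hq0 (hsq hX') i
  have hr := hq0 hX'.inv.posSemidef i
  have hr' := hq0 hZ'.inv.posSemidef i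
  -- With `t = K⁻¹` the lower trace returns exactly to its value before the shift, and `hi` leaves
  -- the upper one room.
  set K := q (Z'⁻¹ * Z'⁻¹) i / E - q Z'⁻¹ i with hK
  have hpD := div_nonneg hp hD0.le
  have hK0 : 0 < K := by linarith
  have ht := inv_pos.2 hK0
  have htK : K⁻¹ * K = 1 := inv_mul_cancel₀ hK0.ne'
  have hU : K⁻¹ * (q (X'⁻¹ * X'⁻¹) i / D + q X'⁻¹ i) < 1 := by
    rw [← htK]; exact mul_lt_mul_of_pos_left hi ht
  have hs1 : 0 < 1 + (-K⁻¹) * (star (v i) ⬝ᵥ X'⁻¹ *ᵥ v i).re := by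
    change 0 < 1 + (-K⁻¹) * q X'⁻¹ i
    have := mul_nonneg ht.le hpD
    linarith
  have hs2 : 0 < 1 + K⁻¹ * (star (v i) ⬝ᵥ Z'⁻¹ *ᵥ v i).re := by
    change 0 < 1 + K⁻¹ * q Z'⁻¹ i
    have := mul_nonneg ht.le hr'
    linarith
  have hneg : X' - ((K⁻¹ : ℝ) : ℂ) • vecMulVec (v i) (star (v i)) =
      X' + ((-K⁻¹ : ℝ) : ℂ) • vecMulVec (v i) (star (v i)) := by
    rw [Complex.ofReal_neg, neg_smul, sub_eq_add_neg]
  refine ⟨i, K⁻¹, ht, ?_, hZ'.add_smul_vecMulVec _ hs2, ?_, ?_⟩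
  · rw [hneg]; exact hX'.add_smul_vecMulVec _ hs1
  · rw [hneg, hX'.trace_inv_add_smul_vecMulVec _ hs1]
    change X'⁻¹.trace.re - -K⁻¹ * q (X'⁻¹ * X'⁻¹) i / (1 + -K⁻¹ * q X'⁻¹ i) ≤ η
    change 0 < 1 + (-K⁻¹) * q X'⁻¹ i at hs1
    have : K⁻¹ * q (X'⁻¹ * X'⁻¹) i / (1 + -K⁻¹ * q X'⁻¹ i) ≤ D := by
      rw [div_le_iff₀ hs1]
      have h := mul_le_mul_of_nonneg_left hU.le hD0.le
      have h2 : D * (q (X'⁻¹ * X'⁻¹) i / D) = q (X'⁻¹ * X'⁻¹) i := mul_div_cancel₀ _ hD0.ne'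
      linear_combination h - K⁻¹ * h2
    rw [neg_mul, neg_div]
    linarith
  · rw [hZ'.trace_inv_add_smul_vecMulVec _ hs2]
    change Z'⁻¹.trace.re - K⁻¹ * q (Z'⁻¹ * Z'⁻¹) i / (1 + K⁻¹ * q Z'⁻¹ i) ≤ η
    change 0 < 1 + K⁻¹ * q Z'⁻¹ i at hs2
    have : E ≤ K⁻¹ * q (Z'⁻¹ * Z'⁻¹) i / (1 + K⁻¹ * q Z'⁻¹ i) := by
      rw [le_div_iff₀ hs2]
      have h2 : E * (q (Z'⁻¹ * Z'⁻¹) i / E) = q (Z'⁻¹ * Z'⁻¹) i := mul_div_cancel₀ _ hE0.ne'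
      have h3 : K⁻¹ * (E * K) = E := by rw [mul_left_comm, htK, mul_one]
      have h4 : E * K = q (Z'⁻¹ * Z'⁻¹) i - E * q Z'⁻¹ i := by rw [hK, mul_sub, h2]
      rw [h4] at h3
      linarith
    linarith

end Matrix

/-! ### The Batson–Spielman–Srivastava theorem -/

namespace Matrix

variable {n : Type*} [Fintype n]

theorem star_dotProduct_sum_smul_vecMulVec {ι : Type*} [Fintype ι] (v : ι → n → ℂ) (s : ι → ℝ)
    (x : n → ℂ) :
    (star x ⬝ᵥ (∑ i, (s i : ℂ) • vecMulVec (v i) (star (v i))) *ᵥ x).re =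
      ∑ i, s i * Complex.normSq (star (v i) ⬝ᵥ x) := by
  rw [sum_mulVec, dotProduct_sum, Complex.re_sum]
  refine Finset.sum_congr rfl fun i _ => ?_
  rw [smul_mulVec, dotProduct_smul, star_dotProduct_vecMulVec_mulVec, smul_eq_mul,
    ← Complex.ofReal_mul, Complex.ofReal_re]

/-- Iterates the barrier step from barriers at `± card n / η`, where both traces equal `η`. Each
step adds at most one index to the support. -/
theorem exists_weights_barriers [DecidableEq n] [Nonempty n] {ι : Type*} [Fintype ι]
    {v : ι → n → ℂ} (hv : ∑ i, vecMulVec (v i) (star (v i)) = 1) {η δ : ℝ} (hη : 0 < η)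
    (hδ : 0 < δ) (hηδ : δ⁻¹ + η < 1 - η) (q : ℕ) :
    ∃ s : ι → ℝ, (∀ i, 0 ≤ s i) ∧ (Finset.univ.filter fun i => s i ≠ 0).card ≤ q ∧
      (((Fintype.card n / η + q * δ : ℝ) : ℂ) • 1 -
        ∑ i, (s i : ℂ) • vecMulVec (v i) (star (v i))).PosDef ∧
      (∑ i, (s i : ℂ) • vecMulVec (v i) (star (v i)) -
        ((q - Fintype.card n / η : ℝ) : ℂ) • 1).PosDef ∧
      (((Fintype.card n / η + q * δ : ℝ) : ℂ) • 1 -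
        ∑ i, (s i : ℂ) • vecMulVec (v i) (star (v i)))⁻¹.trace.re ≤ η ∧
      (∑ i, (s i : ℂ) • vecMulVec (v i) (star (v i)) -
        ((q - Fintype.card n / η : ℝ) : ℂ) • 1)⁻¹.trace.re ≤ η := by
  classical
  induction q with
  | zero =>
    have hd : (0 : ℝ) < Fintype.card n := by exact_mod_cast Fintype.card_pos
    have hc : (0 : ℝ) < Fintype.card n / η := div_pos hd hη
    have hpos : (((Fintype.card n / η : ℝ) : ℂ) • (1 : Matrix n n ℂ)).PosDef :=
      PosDef.one.smul (Complex.zero_lt_real.2 hc)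
    have htr : (((Fintype.card n / η : ℝ) : ℂ) • (1 : Matrix n n ℂ))⁻¹.trace.re ≤ η := by
      have : (((Fintype.card n / η : ℝ) : ℂ) • (1 : Matrix n n ℂ))⁻¹ =
          ((η / Fintype.card n : ℝ) : ℂ) • 1 := by
        refine inv_eq_right_inv ?_
        rw [smul_mul_smul_comm, ← Complex.ofReal_mul, div_mul_div_cancel₀ hη.ne',
          div_self hd.ne']
        simp
      rw [this, trace_smul, trace_one, smul_eq_mul, Complex.re_ofReal_mul, Complex.natCast_re,
        div_mul_cancel₀ _ hd.ne']
    have e1 : (((Fintype.card n / η + (0 : ℕ) * δ : ℝ) : ℂ) • (1 : Matrix n n ℂ) -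
        ∑ i, (((0 : ι → ℝ) i : ℝ) : ℂ) • vecMulVec (v i) (star (v i))) =
        ((Fintype.card n / η : ℝ) : ℂ) • 1 := by simp
    have e2 : (∑ i, (((0 : ι → ℝ) i : ℝ) : ℂ) • vecMulVec (v i) (star (v i)) -
        (((0 : ℕ) - Fintype.card n / η : ℝ) : ℂ) • (1 : Matrix n n ℂ)) =
        ((Fintype.card n / η : ℝ) : ℂ) • 1 := by simp
    refine ⟨0, by simp, by simp, ?_⟩
    rw [e1, e2]
    exact ⟨hpos, hpos, htr, htr⟩
  | succ q ih =>
    obtain ⟨s, hs0, hsc, hX, hZ, hXη, hZη⟩ := ih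
    obtain ⟨i, t, ht, h⟩ := exists_barrier_step hv hX hZ hδ hηδ hXη hZη
    have hsum : ∑ j, (((s + Pi.single i t : ι → ℝ) j : ℝ) : ℂ) • vecMulVec (v j) (star (v j)) =
        ∑ j, (s j : ℂ) • vecMulVec (v j) (star (v j)) +
          (t : ℂ) • vecMulVec (v i) (star (v i)) := by
      simp only [Pi.add_apply, Complex.ofReal_add, add_smul, Finset.sum_add_distrib]
      congr 1
      rw [Finset.sum_eq_single i]
      · simp
      · intro j _ hj
        simp [hj]
      · simp
    refine ⟨s + Pi.single i t, fun j => ?_, ?_, ?_⟩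
    · refine add_nonneg (hs0 j) ?_
      rcases eq_or_ne j i with rfl | hj
      · simpa using ht.le
      · simp [hj]
    · refine (Finset.card_le_card (t := insert i (Finset.univ.filter fun i => s i ≠ 0))
        fun j hj => ?_).trans ((Finset.card_insert_le _ _).trans (Nat.succ_le_succ hsc))
      rcases eq_or_ne j i with rfl | hji
      · exact Finset.mem_insert_self _ _
      · simpa [hji] using hj
    · rw [hsum]
      set A := ∑ j, (s j : ℂ) • vecMulVec (v j) (star (v j))
      have e1 : ((Fintype.card n / η + (q + 1 : ℕ) * δ : ℝ) : ℂ) • (1 : Matrix n n ℂ) -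
          (A + (t : ℂ) • vecMulVec (v i) (star (v i))) =
          ((Fintype.card n / η + q * δ : ℝ) : ℂ) • 1 - A + (δ : ℂ) • 1 -
            (t : ℂ) • vecMulVec (v i) (star (v i)) := by
        push_cast; module
      have e2 : A + (t : ℂ) • vecMulVec (v i) (star (v i)) -
          (((q + 1 : ℕ) - Fintype.card n / η : ℝ) : ℂ) • (1 : Matrix n n ℂ) =
          A - ((q - Fintype.card n / η : ℝ) : ℂ) • 1 - 1 +
            (t : ℂ) • vecMulVec (v i) (star (v i)) := by
        push_cast; module
      rw [e1, e2]
      exact h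

/-- Batson–Spielman–Srivastava: a decomposition of the identity into rank-one matrices has an
`ε`-approximation that uses linearly many of them. -/
theorem exists_sparse_of_sum_vecMulVec_eq_one [DecidableEq n] {ι : Type*} [Fintype ι]
    {v : ι → n → ℂ} (hv : ∑ i, vecMulVec (v i) (star (v i)) = 1) {ε : ℝ} (hε : 0 < ε)
    (hε1 : ε < 1) :
    ∃ s : ι → ℝ, (∀ i, 0 ≤ s i) ∧
      ((Finset.univ.filter fun i => s i ≠ 0).card : ℝ) ≤ 65 * Fintype.card n / ε ^ 2 ∧
      ∀ x, (1 - ε) * ∑ i, Complex.normSq (star (v i) ⬝ᵥ x) ≤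
          ∑ i, s i * Complex.normSq (star (v i) ⬝ᵥ x) ∧
        ∑ i, s i * Complex.normSq (star (v i) ⬝ᵥ x) ≤
          (1 + ε) * ∑ i, Complex.normSq (star (v i) ⬝ᵥ x) := by
  cases isEmpty_or_nonempty n with
  | inl _ => exact ⟨0, by simp, by simp, fun x => by simp [dotProduct]⟩
  | inr _ =>
  set d : ℝ := (Fintype.card n : ℝ) with hd
  have hd1 : 1 ≤ d := by rw [hd]; exact_mod_cast Fintype.card_pos
  set η := ε / 8 with hη_def
  have hη : 0 < η := by positivity
  have hη8 : η ≤ 1 / 8 := by linarith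
  have h3 : 0 < 1 - 3 * η := by linarith
  -- This gives `δ⁻¹ + η = 1 - 2η`, below the required `1 - η`.
  set δ := (1 - 3 * η)⁻¹ with hδ_def
  have hδ : 0 < δ := inv_pos.2 h3
  -- Since `64 d / ε² = d / η²`, the initial offset `d / η` is at most `η q`. After division by `q`
  -- the barriers lie within `[1 - η, 1 + 6η]`.
  set q := ⌈64 * d / ε ^ 2⌉₊
  have hq1 : 64 * d / ε ^ 2 ≤ q := Nat.le_ceil _
  have hq2 : (q : ℝ) < 64 * d / ε ^ 2 + 1 := Nat.ceil_lt_add_one (by positivity)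
  have hq0 : (0 : ℝ) < q := lt_of_lt_of_le (by positivity) hq1
  obtain ⟨s, hs0, hsc, hX, hZ, -, -⟩ := exists_weights_barriers hv hη hδ
    (by rw [hδ_def, inv_inv]; linarith) q
  have hdη : d / η ≤ η * q := by
    have : d / η = η * (64 * d / ε ^ 2) := by rw [hη_def]; field_simp; norm_num
    rw [this]
    exact mul_le_mul_of_nonneg_left hq1 hη.le
  have hδ5 : δ ≤ 1 + 5 * η := by
    rw [hδ_def, inv_le_iff_one_le_mul₀ h3]
    nlinarith
  refine ⟨fun i => s i / q, fun i => div_nonneg (hs0 i) hq0.le, ?_, fun x => ?_⟩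
  · have hcard : (Finset.univ.filter fun i => s i / q ≠ 0) =
        Finset.univ.filter fun i => s i ≠ 0 := by
      simp [hq0.ne', div_eq_zero_iff]
    rw [hcard]
    -- The 65th unit pays for rounding `q` up.
    have h1 : 1 ≤ d / ε ^ 2 := by
      rw [le_div_iff₀ (by positivity)]
      nlinarith
    have h2 : (65 : ℝ) * d / ε ^ 2 = 64 * d / ε ^ 2 + d / ε ^ 2 := by ring
    have h4 : ((Finset.univ.filter fun i => s i ≠ 0).card : ℝ) ≤ q := by exact_mod_cast hsc
    linarith
  · have hN : (star x ⬝ᵥ x).re = ∑ i, Complex.normSq (star (v i) ⬝ᵥ x) := by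
      have := star_dotProduct_sum_smul_vecMulVec v (fun _ => 1) x
      simpa [hv] using this
    have hN0 : 0 ≤ ∑ i, Complex.normSq (star (v i) ⬝ᵥ x) :=
      Finset.sum_nonneg fun i _ => Complex.normSq_nonneg _
    have hu := (Complex.nonneg_iff.1 (hX.posSemidef.dotProduct_mulVec_nonneg x)).1
    have hl := (Complex.nonneg_iff.1 (hZ.posSemidef.dotProduct_mulVec_nonneg x)).1
    rw [sub_mulVec, dotProduct_sub, Complex.sub_re, star_dotProduct_sum_smul_vecMulVec,
      smul_mulVec, one_mulVec, dotProduct_smul, smul_eq_mul, Complex.re_ofReal_mul, hN] at hu hl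
    set N := ∑ i, Complex.normSq (star (v i) ⬝ᵥ x)
    have hS : ∑ i, s i / q * Complex.normSq (star (v i) ⬝ᵥ x) =
        (∑ i, s i * Complex.normSq (star (v i) ⬝ᵥ x)) / q := by
      rw [Finset.sum_div]
      exact Finset.sum_congr rfl fun i _ => by ring
    rw [hS, le_div_iff₀ hq0, div_le_iff₀ hq0]
    have hqδ := mul_le_mul_of_nonneg_left hδ5 hq0.le
    have hηq := mul_pos hη hq0
    have e : ε = 8 * η := by rw [hη_def]; ring
    have a1 : (1 - ε) * q ≤ q - d / η := by rw [e]; nlinarith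
    have a2 : d / η + q * δ ≤ (1 + ε) * q := by rw [e]; nlinarith
    have b1 := mul_le_mul_of_nonneg_right a1 hN0
    have b2 := mul_le_mul_of_nonneg_right a2 hN0
    constructor <;> linarith

/-- The theorem of Batson, Spielman and Srivastava for an arbitrary sum of rank-one matrices. -/
theorem exists_sparse_sum_normSq_dotProduct {ι : Type*} [Fintype ι] (v : ι → n → ℂ) {ε : ℝ}
    (hε : 0 < ε) (hε1 : ε < 1) :
    ∃ s : ι → ℝ, (∀ i, 0 ≤ s i) ∧
      ((Finset.univ.filter fun i => s i ≠ 0).card : ℝ) ≤ 65 * Fintype.card n / ε ^ 2 ∧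
      ∀ x, (1 - ε) * ∑ i, Complex.normSq (star (v i) ⬝ᵥ x) ≤
          ∑ i, s i * Complex.normSq (star (v i) ⬝ᵥ x) ∧
        ∑ i, s i * Complex.normSq (star (v i) ⬝ᵥ x) ≤
          (1 + ε) * ∑ i, Complex.normSq (star (v i) ⬝ᵥ x) := by
  classical
  have hL : (∑ i, vecMulVec (v i) (star (v i))).PosSemidef :=
    posSemidef_sum _ fun i _ => posSemidef_vecMulVec_self_star _
  set L := ∑ i, vecMulVec (v i) (star (v i)) with hL_def
  set lam := hL.isHermitian.eigenvalues
  let U : Matrix n n ℂ := hL.isHermitian.eigenvectorUnitary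
  have hUU : U * star U = 1 := Unitary.coe_mul_star_self hL.isHermitian.eigenvectorUnitary
  have hUU' : star U * U = 1 := Unitary.coe_star_mul_self hL.isHermitian.eigenvectorUnitary
  have hdiag : star U * L * U = diagonal (fun j => (lam j : ℂ)) := by
    have hs : L = U * diagonal (fun j => (lam j : ℂ)) * star U :=
      hL.isHermitian.eq_unitaryDiag
    rw [hs, mul_assoc, mul_assoc, hUU', mul_one, ← mul_assoc, hUU', one_mul]
  let a (i : ι) : n → ℂ := star U *ᵥ v i
  have hstar (x : n → ℂ) : star (star U *ᵥ x) = star x ᵥ* U := by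
    rw [star_mulVec, star_eq_conjTranspose, conjTranspose_conjTranspose]
  have hsum (j k : n) : ∑ i, a i j * conj (a i k) = if j = k then (lam j : ℂ) else 0 := by
    have : ∑ i, vecMulVec (a i) (star (a i)) = diagonal (fun j => (lam j : ℂ)) := by
      rw [← hdiag, hL_def, Finset.mul_sum, Finset.sum_mul]
      refine Finset.sum_congr rfl fun i _ => ?_
      rw [mul_vecMulVec, vecMulVec_mul, ← hstar]
    have := congrFun (congrFun this j) k
    rw [sum_apply, diagonal_apply] at this
    simpa [vecMulVec_apply] using this
  have hzero (j : n) (hj : lam j = 0) (i : ι) : a i j = 0 := by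
    have h := hsum j j
    simp only [if_true, hj, Complex.mul_conj, ← Complex.ofReal_sum, Complex.ofReal_inj] at h
    exact Complex.normSq_eq_zero.1
      ((Finset.sum_eq_zero_iff_of_nonneg fun i _ => Complex.normSq_nonneg _).1 h i
        (Finset.mem_univ i))
  have hlam (j : {j // lam j ≠ 0}) : 0 < √(lam j) :=
    Real.sqrt_pos.2 (lt_of_le_of_ne (hL.eigenvalues_nonneg j) j.2.symm)
  -- Whitening: on the range of `L`, dividing eigencoordinates by `√lam` makes the rank-one sum the
  -- identity. The other coordinates of every vector vanish by `hzero`.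
  let w (i : ι) (j : {j // lam j ≠ 0}) : ℂ := a i j / (√(lam j) : ℝ)
  have hw : ∑ i, vecMulVec (w i) (star (w i)) = 1 := by
    ext j k
    have h (i : ι) : w i j * star (w i k) =
        a i j * conj (a i k) / ((√(lam j) * √(lam k) : ℝ) : ℂ) := by
      simp only [w, RCLike.star_def, map_div₀, Complex.conj_ofReal, Complex.ofReal_mul]
      rw [div_mul_div_comm]
    simp only [sum_apply, vecMulVec_apply, Pi.star_apply, h]
    rw [← Finset.sum_div, hsum, one_apply]
    by_cases hjk : j = k
    · subst hjk
      rw [if_pos rfl, if_pos rfl, Real.mul_self_sqrt (hL.eigenvalues_nonneg _),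
        div_self (Complex.ofReal_ne_zero.2 j.2)]
    · rw [if_neg fun h => hjk (Subtype.ext h), if_neg hjk, zero_div]
  obtain ⟨s, hs0, hsc, hs⟩ := exists_sparse_of_sum_vecMulVec_eq_one hw hε hε1
  refine ⟨s, hs0, hsc.trans ?_, fun x => ?_⟩
  · have : (Fintype.card {j // lam j ≠ 0} : ℝ) ≤ Fintype.card n := by
      exact_mod_cast Fintype.card_subtype_le _
    gcongr
  · have hx (i : ι) : star (v i) ⬝ᵥ x =
        star (w i) ⬝ᵥ fun j : {j // lam j ≠ 0} => (√(lam j) : ℂ) * (star U *ᵥ x) j := by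
      have h1 : star (v i) ⬝ᵥ x = star (a i) ⬝ᵥ star U *ᵥ x := by
        rw [hstar, dotProduct_mulVec, vecMul_vecMul, hUU, vecMul_one]
      have h2 : star (a i) ⬝ᵥ star U *ᵥ x =
          ∑ j : {j // lam j ≠ 0}, star (a i j) * (star U *ᵥ x) j := by
        rw [dotProduct, ← Finset.sum_subtype (Finset.univ.filter fun j => lam j ≠ 0) (by simp)
          fun j => star (a i j) * (star U *ᵥ x) j, Finset.sum_filter_of_ne]
        · rfl
        · intro j _ hj hj0
          exact hj (by rw [hzero j hj0, star_zero, zero_mul])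
      rw [h1, h2, dotProduct]
      refine Finset.sum_congr rfl fun j _ => ?_
      have := Complex.ofReal_ne_zero.2 (hlam j).ne'
      simp only [w, Pi.star_apply, RCLike.star_def, map_div₀, Complex.conj_ofReal]
      field_simp
    simp only [hx]
    exact hs _

end Matrix

/-! ### Classification of the sixteen predicates -/

theorem BinaryPredicate.eq_and_of_numSatisfying_eq_one (P : BinaryPredicate)
    (h : P.numSatisfying = 1) : ∃ a b : Bool, ∀ x y, P (x, y) = (x == a && y == b) := by
  revert P
  decide

theorem BinaryPredicate.classification_of_numSatisfying_ne_one (P : BinaryPredicate)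
    (h : P.numSatisfying ≠ 1) :
    (∃ a : Bool, ∀ x y, P (x, y) = a) ∨ (∃ a : Bool, ∀ x y, P (x, y) = (x == a)) ∨
      (∃ b : Bool, ∀ x y, P (x, y) = (y == b)) ∨ (∃ c : Bool, ∀ x y, P (x, y) = (x != (y ^^ c))) ∨
      ∃ a b : Bool, ∀ x y, P (x, y) = !(x == a && y == b) := by
  revert P
  decide

/-- A predicate whose number of satisfying inputs is not one is the squared modulus of a sum of
two complex functions of one variable each. -/
theorem BinaryPredicate.exists_normSq_add_eq (P : BinaryPredicate) (h : P.numSatisfying ≠ 1) :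
    ∃ f g : Bool → ℂ, ∀ x y, Complex.normSq (f x + g y) = if P (x, y) = true then 1 else 0 := by
  rcases P.classification_of_numSatisfying_ne_one h with
    ⟨a, hP⟩ | ⟨a, hP⟩ | ⟨b, hP⟩ | ⟨c, hP⟩ | ⟨a, b, hP⟩
  · refine ⟨fun _ => if a then 1 else 0, fun _ => 0, fun x y => ?_⟩
    rw [hP]
    cases a <;> simp
  · refine ⟨fun x => if x = a then 1 else 0, fun _ => 0, fun x y => ?_⟩
    rw [hP]
    cases a <;> cases x <;> simp
  · refine ⟨fun _ => 0, fun y => if y = b then 1 else 0, fun x y => ?_⟩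
    rw [hP]
    cases b <;> cases y <;> simp
  · refine ⟨fun x => if x then 1 else 0, fun y => if y ^^ c then -1 else 0, fun x y => ?_⟩
    rw [hP]
    cases c <;> cases x <;> cases y <;> simp
  -- The values are 1 and the cube root of unity `ω`, for which `|1 + ω| = 1`. This case forces
  -- complex numbers: two real numbers of modulus 1 never sum to one of modulus 1.
  · have h3 : √3 * √3 = (3 : ℝ) := Real.mul_self_sqrt (by norm_num)
    refine ⟨fun x => if x = a then 0 else 1, fun y => if y = b then 0 else ⟨-1 / 2, √3 / 2⟩,
      fun x y => ?_⟩
    rw [hP]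
    rcases eq_or_ne x a with rfl | hx <;> rcases eq_or_ne y b with rfl | hy <;>
      simp [*, Complex.normSq_apply] <;> linarith

/-! ### The two halves of the dichotomy -/

namespace VCSP

variable {V : Type u}

theorem exists_sparsifier [Fintype V] {P : BinaryPredicate} (hP : P.numSatisfying ≠ 1) {ε : ℝ}
    (hε : 0 < ε) (hε1 : ε < 1) (I : VCSP V) (hI : I.UsesOnly P) :
    ∃ J : VCSP V, IsSparsifier ε J I ∧
      (J.constraints.card : ℝ) ≤ 130 * (Fintype.card V : ℝ) / ε ^ 2 := by
  classical
  obtain ⟨f, g, hfg⟩ := P.exists_normSq_add_eq hP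
  -- The conjugate cancels the `star` in the inner product. Adding the two terms also handles a
  -- constraint whose variables coincide.
  let b (c : I.constraints) (p : V × Bool) : ℂ :=
    conj ((√(I.weight c) : ℝ) * ((if p.1 = c.1.scope.1 then f p.2 else 0) +
      if p.1 = c.1.scope.2 then g p.2 else 0))
  let chi (A : V → Bool) (p : V × Bool) : ℂ := if A p.1 = p.2 then 1 else 0
  have hb (c : I.constraints) (A : V → Bool) : Complex.normSq (star (b c) ⬝ᵥ chi A) =
      (I.weight c : ℝ) * (if c.1.IsSatisfiedBy A then 1 else 0) := by
    have h1 : star (b c) ⬝ᵥ chi A =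
        (√(I.weight c) : ℝ) * (f (A c.1.scope.1) + g (A c.1.scope.2)) := by
      simp [dotProduct, b, chi, Fintype.sum_prod_type, ← Finset.mul_sum, Finset.sum_add_distrib]
    rw [h1, map_mul, Complex.normSq_ofReal, Real.mul_self_sqrt (NNReal.coe_nonneg _), hfg,
      ← hI c.1 c.2]
    rfl
  obtain ⟨s, hs0, hsc, hs⟩ := exists_sparse_sum_normSq_dotProduct b hε hε1
  let J : VCSP V :=
    { constraints := (Finset.univ.filter fun c => s c ≠ 0).map (Function.Embedding.subtype _)
      weight := fun c => if h : c ∈ I.constraints then I.weight c * (s ⟨c, h⟩).toNNReal else 0 }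
  have hIval (A : V → Bool) : I.value A = ∑ c, Complex.normSq (star (b c) ⬝ᵥ chi A) := by
    simp only [hb]
    exact (Finset.sum_coe_sort I.constraints fun c =>
      (I.weight c : ℝ) * (if c.IsSatisfiedBy A then 1 else 0)).symm
  have hJval (A : V → Bool) : J.value A = ∑ c, s c * Complex.normSq (star (b c) ⬝ᵥ chi A) := by
    simp only [hb]
    rw [value, Finset.sum_map, ← Finset.sum_filter_of_ne (s := Finset.univ) (p := fun c => s c ≠ 0)
      (f := fun c : I.constraints =>
        s c * ((I.weight c : ℝ) * (if c.1.IsSatisfiedBy A then 1 else 0)))]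
    · refine Finset.sum_congr rfl fun c _ => ?_
      have hw : J.weight c = I.weight c * (s c).toNNReal := dif_pos c.2
      rw [Function.Embedding.subtype_apply, hw, NNReal.coe_mul, Real.coe_toNNReal _ (hs0 c)]
      ring
    · intro c _ hc hc0
      exact hc (by rw [hc0, zero_mul])
  refine ⟨J, ⟨fun c hc => ?_, fun A => ?_⟩, ?_⟩
  · obtain ⟨c, -, rfl⟩ := Finset.mem_map.1 hc
    exact c.2
  · rw [hIval, hJval]
    exact hs _
  · rw [Finset.card_map]
    refine hsc.trans (le_of_eq ?_)
    rw [Fintype.card_prod, Fintype.card_bool]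
    push_cast
    ring

theorem exists_isSatisfiedBy_of_value_pos {I : VCSP V} {A : V → Bool} (h : 0 < I.value A) :
    ∃ c ∈ I.constraints, c.IsSatisfiedBy A := by
  by_contra! hc
  refine h.ne' (Finset.sum_eq_zero fun c hcI => ?_)
  rw [if_neg (hc c hcI), mul_zero]

/-- The instance has all pairs from a half `L` of `V` to its complement, so the values at first and
at second variables can be set independently. -/
theorem exists_dense_of_numSatisfying_eq_one [Fintype V] {P : BinaryPredicate}
    (hP : P.numSatisfying = 1) {ε : ℝ} (hε1 : ε < 1) (hV : 2 ≤ Fintype.card V) :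
    ∃ I : VCSP V, I.UsesOnly P ∧ ∀ J : VCSP V, IsSparsifier ε J I →
      1 / 8 * (Fintype.card V : ℝ) ^ 2 ≤ (J.constraints.card : ℝ) := by
  classical
  obtain ⟨a, b, hab⟩ := P.eq_and_of_numSatisfying_eq_one hP
  obtain ⟨L, -, hL⟩ := Finset.exists_subset_card_eq (s := (Finset.univ : Finset V))
    (n := Fintype.card V / 2) (Nat.div_le_self _ _)
  let I : VCSP V :=
    { constraints := (L ×ˢ Lᶜ).map ⟨fun p => ⟨p, P⟩, fun p q h => (VCSPConstraint.mk.inj h).1⟩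
      weight := fun _ => 1 }
  have hmem (c : VCSPConstraint V) :
      c ∈ I.constraints ↔ c.scope.1 ∈ L ∧ c.scope.2 ∉ L ∧ c.pred = P := by
    rcases c with ⟨⟨v, u⟩, Q⟩
    refine Finset.mem_map.trans ⟨?_, ?_⟩
    · rintro ⟨p, hp, h⟩
      obtain ⟨rfl, rfl⟩ := VCSPConstraint.mk.inj h
      simpa using hp
    · rintro ⟨h1, h2, rfl⟩
      exact ⟨(v, u), by simpa using ⟨h1, h2⟩, rfl⟩
  refine ⟨I, fun c hc => ((hmem c).1 hc).2.2, fun J hJ => ?_⟩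
  have hsub : I.constraints ⊆ J.constraints := by
    intro c hc
    obtain ⟨h1, h2, h3⟩ := (hmem c).1 hc
    -- The assignment that isolates `c`: among first variables only that of `c` gets `a`, among
    -- second ones only that of `c` gets `b`.
    let A (z : V) : Bool :=
      if z ∈ L then (if z = c.scope.1 then a else !a) else (if z = c.scope.2 then b else !b)
    have hcA : c.IsSatisfiedBy A := by
      simp [VCSPConstraint.IsSatisfiedBy, h3, hab, A, h1, h2]
    have hI1 : 1 ≤ I.value A := by
      have := Finset.single_le_sum (s := I.constraints)
        (f := fun c => (I.weight c : ℝ) * (if c.IsSatisfiedBy A then 1 else 0))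
        (fun c _ => mul_nonneg (I.weight c).2 (by split_ifs <;> norm_num)) hc
      rwa [if_pos hcA, mul_one] at this
    have hJ1 : 0 < J.value A :=
      (mul_pos (sub_pos.2 hε1) (by linarith)).trans_le (hJ.2 A).1
    obtain ⟨c', hc', hsat⟩ := exists_isSatisfiedBy_of_value_pos hJ1
    obtain ⟨h1', h2', h3'⟩ := (hmem c').1 (hJ.1 hc')
    have hcc : c' = c := by
      rcases c with ⟨⟨v, u⟩, Q⟩
      rcases c' with ⟨⟨v', u'⟩, Q'⟩
      dsimp only at h1 h2 h3 h1' h2' h3'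
      subst h3 h3'
      simp only [VCSPConstraint.IsSatisfiedBy, hab, A, h1', h2', if_true, if_false,
        Bool.and_eq_true, beq_iff_eq] at hsat
      have e1 : v' = v := by
        by_contra h
        simp [h] at hsat
      have e2 : u' = u := by
        by_contra h
        simp [h] at hsat
      rw [e1, e2]
    exact hcc ▸ hc'
  have hcard : I.constraints.card =
      Fintype.card V / 2 * (Fintype.card V - Fintype.card V / 2) := by
    rw [Finset.card_map, Finset.card_product, Finset.card_compl, hL]
  have hle := Finset.card_le_card hsub
  rw [hcard] at hle
  -- The factor 8 leaves room for the floor in the odd case, which uses `m ≥ 1`.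
  have key : Fintype.card V ^ 2 ≤ 8 * J.constraints.card := by
    refine le_trans ?_ (Nat.mul_le_mul_left 8 hle)
    obtain ⟨m, hm⟩ := Nat.even_or_odd' (Fintype.card V)
    rcases hm with hm | hm
    · rw [hm, show 2 * m / 2 = m by omega, show 2 * m - m = m by omega]
      nlinarith
    · rw [hm, show (2 * m + 1) / 2 = m by omega, show 2 * m + 1 - m = m + 1 by omega]
      have : 1 ≤ m := by omega
      nlinarith
  have key' : (Fintype.card V : ℝ) ^ 2 ≤ 8 * J.constraints.card := by exact_mod_cast key
  linarith

end VCSP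

theorem mainTheorem1 :
    ∃ c C : ℝ, 0 < c ∧ 0 < C ∧
      ∀ (P : BinaryPredicate) (ε : ℝ), 0 < ε → ε < 1 →
        (P.numSatisfying = 1 →
          ∀ (V : Type u) [Fintype V], 2 ≤ Fintype.card V →
            ∃ I : VCSP V, I.UsesOnly P ∧
              ∀ J : VCSP V, VCSP.IsSparsifier ε J I →
                c * (Fintype.card V : ℝ) ^ 2 ≤ (J.constraints.card : ℝ)) ∧
        (P.numSatisfying ≠ 1 →
          ∀ (V : Type u) [Fintype V] (I : VCSP V), I.UsesOnly P →
            ∃ J : VCSP V, VCSP.IsSparsifier ε J I ∧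
              (J.constraints.card : ℝ) ≤ C * (Fintype.card V : ℝ) / ε ^ 2) :=
  ⟨1 / 8, 130, by norm_num, by norm_num, fun _ _ hε hε1 =>
    ⟨fun hP _ _ hV => VCSP.exists_dense_of_numSatisfying_eq_one hP hε1 hV,
      fun hP _ _ I hI => VCSP.exists_sparsifier hP hε hε1 I hI⟩⟩
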